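/- Let $N\ge 2$ and $S_1,\dots,S_N\ge 1$ be integers, let $\mathcal H_1,\dots,\mathcal H_N$ be complex separable Hilbert spaces, let $\rho$ be a quantum state (a positive trace class operator of trace one) on the Hilbert space tensor product $\mathcal H_1\otimes\cdots\otimes\mathcal H_N$, and let $(\Lambda_n,\mathcal F_{\Lambda_n})$, $n=1,\dots,N$, be standard measurable spaces; put $\Lambda=\Lambda_1\times\cdots\times\Lambda_N$ with the product $\sigma$-algebra. A collection $\mathrm M=\{\mathrm M_n^{(s_n)}: s_n=1,\dots,S_n,\ n=1,\dots,N\}$ of normalized positive operator-valued (POV) measures $\mathrm M_n^{(s_n)}$ on $\Lambda_n$, with values in the bounded operators on $\mathcal H_n$, defines the quantum correlation scenario $\mathcal E_{\rho,\mathrm M}$ with the joint probability distributions $P_{(s_1,\dots,s_N)}$ on $\Lambda$ given by $$P_{(s_1,\dots,s_N)}(F_1\times\cdots\times F_N)=\mathrm{tr}\big[\rho\,\{\mathrm M_1^{(s_1)}(F_1)\otimes\cdots\otimes\mathrm M_N^{(s_N)}(F_N)\}\big],\qquad F_n\in\mathcal F_{\Lambda_n}.$$ Let $\gamma_{\mathcal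 E_{\rho,\mathrm M}}$ be the infimum of the total variation norms $\|\mu\|_{var}$ over all bounded real-valued measures $\mu$ on $\Lambda_1^{S_1}\times\cdots\times\Lambda_N^{S_N}$ with total mass $1$ that return every $P_{(s_1,\dots,s_N)}$ as the marginal on the coordinates $(\lambda_1^{(s_1)},\dots,\lambda_N^{(s_N)})$, and let $\Upsilon^{(\rho,\Lambda)}_{S_1\times\cdots\times S_N}:=\sup_{\mathrm M}\gamma_{\mathcal E_{\rho,\mathrm M}}$. For a family $\Psi=\{\psi_{(s_1,\dots,s_N)}\}$ of bounded measurable real-valued functions on $\Lambda$, and a correlation scenario $\mathcal E$ (one probability distribution $P_{(s_1,\dots,s_N)}$ on $\Lambda$ for each tuple of settings), write $\langle\psi_{(s_1,\dots,s_N)}\rangle_{\mathcal E}=\int_\Lambda\psi_{(s_1,\dots,s_N)}\,\mathrm dP_{(s_1,\dots,s_N)}$. The scenario admits a local hidden variable (LHV) model if there are a probability space $(\Omega,\nu)$ and conditional probability measures $P_n^{(s_n)}(\cdot\,|\,\omega)$ on $\Lambda_n$, measurable in $\omega\in\Omega$, with $P_{(s_1,\dots,s_N)}(F_1\times\cdots\times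 F_N)=\int_\Omega\prod_{n}P_n^{(s_n)}(F_n|\omega)\,\nu(\mathrm d\omega)$ for all settings and all $F_n\in\mathcal F_{\Lambda_n}$. Let $$\mathcal B_\Psi:=\max\Big\{\Big|\sup_{\mathcal E}\sum_{s_1,\dots,s_N}\langle\psi_{(s_1,\dots,s_N)}\rangle_{\mathcal E}\Big|,\ \Big|\inf_{\mathcal E}\sum_{s_1,\dots,s_N}\langle\psi_{(s_1,\dots,s_N)}\rangle_{\mathcal E}\Big|\Big\},$$ where the supremum and the infimum are over all scenarios $\mathcal E$ (with these settings and outcome sets) that admit an LHV model. Then, as elements of $[0,\infty]$, $$\Upsilon^{(\rho,\Lambda)}_{S_1\times\cdots\times S_N}=\sup_{\mathrm M,\ \Psi,\ \mathcal B_\Psi\ne 0}\ \Big|\frac{1}{\mathcal B_\Psi}\sum_{s_1,\dots,s_N}\langle\psi_{(s_1,\dots,s_N)}\rangle_{\mathcal E_{\rho,\mathrm M}}\Big|,$$ where the supremum is over all collections $\mathrm M$ of POV measures as above and all families $\Psi$ of bounded measurable real-valued functions on $\Lambda$ with $\mathcal B_\Psi\neq 0$. -/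

import Mathlib

universe v

noncomputable section

namespace BellViolation

section HilbertTensorProduct

open scoped TensorProduct InnerProductSpace ComplexConjugate ComplexOrder Matrix

variable {ι : Type*} (H : ι → Type*) [∀ n, NormedAddCommGroup (H n)]
  [∀ n, InnerProductSpace ℂ (H n)]

/-- The algebraic tensor product of the spaces `H n`. A separate name is used because the
Mathlib type `⨂[ℂ] n, H n` already carries the (different) projective seminorm. -/
def AlgTensor : Type _ := ⨂[ℂ] n, H n

instance AlgTensor.instAddCommGroup : AddCommGroup (AlgTensor H) := inferInstanceAs (AddCommGroup (⨂[ℂ] n, H n))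

instance AlgTensor.instModule : Module ℂ (AlgTensor H) := inferInstanceAs (Module ℂ (⨂[ℂ] n, H n))

variable {H}

/-- The elementary tensor `⊗ₙ x n` in the algebraic tensor product. -/
def algTmul (x : ∀ n, H n) : AlgTensor H := PiTensorProduct.tprod ℂ x

/-- The linear map on the algebraic tensor product induced by a multilinear map. -/
def algLift (φ : MultilinearMap ℂ H ℂ) : AlgTensor H →ₗ[ℂ] ℂ :=
  (PiTensorProduct.lift φ : (⨂[ℂ] n, H n) →ₗ[ℂ] ℂ)

theorem algLift_algTmul (φ : MultilinearMap ℂ H ℂ) (x : ∀ n, H n) :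
    algLift φ (algTmul x) = φ x :=
  PiTensorProduct.lift.tprod (φ := φ) x

theorem exists_eq_sum (t : AlgTensor H) :
    ∃ (m : ℕ) (c : Fin m → ℂ) (x : Fin m → ∀ n, H n), t = ∑ k, c k • algTmul (x k) := by
  have key : ∀ t' : ⨂[ℂ] n, H n, ∃ (m : ℕ) (c : Fin m → ℂ) (x : Fin m → ∀ n, H n),
      t' = ∑ k, c k • PiTensorProduct.tprod ℂ (x k) := by
    intro t'
    have ht : t' ∈ Submodule.span ℂ (Set.range (PiTensorProduct.tprod ℂ (s := H))) := by
      rw [PiTensorProduct.span_tprod_eq_top]; trivial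
    obtain ⟨m, c, g, h⟩ := Submodule.mem_span_set'.1 ht
    choose x hx using fun k => (g k).2
    refine ⟨m, c, x, ?_⟩
    rw [← h]
    exact Finset.sum_congr rfl fun k _ => by rw [← hx k]
  exact key t

/-- The algebraic tensor product `⊗ₙ X n` of bounded operators. -/
def algTensorMap (X : ∀ n, H n →L[ℂ] H n) : AlgTensor H →ₗ[ℂ] AlgTensor H :=
  (PiTensorProduct.map fun n => (X n).toLinearMap :
    (⨂[ℂ] n, H n) →ₗ[ℂ] ⨂[ℂ] n, H n)

theorem algTensorMap_algTmul (X : ∀ n, H n →L[ℂ] H n) (x : ∀ n, H n) :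
    algTensorMap X (algTmul x) = algTmul fun n => X n (x n) :=
  PiTensorProduct.map_tprod _ _

/-- The entrywise product over `n` of the Gram matrices of the families `k ↦ x k n`. -/
def prodGram {m : ℕ} (s : Finset ι) (x : Fin m → ∀ n, H n) : Matrix (Fin m) (Fin m) ℂ :=
  Matrix.of fun k j => ∏ n ∈ s, ⟪x k n, x j n⟫_ℂ

theorem prodGram_insert [DecidableEq ι] {m : ℕ} {s : Finset ι} {a : ι} (ha : a ∉ s)
    (x : Fin m → ∀ n, H n) :
    prodGram (insert a s) x =
      Matrix.hadamard (Matrix.gram ℂ fun k => x k a) (prodGram s x) := by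
  ext k j
  simp [prodGram, Finset.prod_insert ha]

theorem posSemidef_prodGram {m : ℕ} (s : Finset ι) (x : Fin m → ∀ n, H n) :
    (prodGram s x).PosSemidef := by
  classical
  induction s using Finset.induction_on with
  | empty =>
    have : prodGram (∅ : Finset ι) x = Matrix.gram ℂ fun _ : Fin m => (1 : ℂ) := by
      ext k j
      simp [prodGram]
    rw [this]
    exact Matrix.posSemidef_gram ℂ _
  | insert a s ha ih =>
    rw [prodGram_insert ha]
    exact (Matrix.posSemidef_gram ℂ _).hadamard ih

theorem posSemidef_prodGram_sub {m : ℕ} (X : ∀ n, H n →L[ℂ] H n) (s : Finset ι)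
    (x : Fin m → ∀ n, H n) :
    ((∏ n ∈ s, ‖X n‖ ^ 2) • prodGram s x - prodGram s fun k n => X n (x k n)).PosSemidef := by
  classical
  induction s using Finset.induction_on with
  | empty =>
    have : (∏ n ∈ (∅ : Finset ι), ‖X n‖ ^ 2) • prodGram (∅ : Finset ι) x -
        (prodGram (∅ : Finset ι) fun k n => X n (x k n)) = 0 := by
      ext k j
      simp [prodGram]
    rw [this]
    exact Matrix.PosSemidef.zero
  | insert a s ha ih =>
    have h1 := Matrix.posSemidef_opNorm_smul_gram_sub_gram (fun k => x k a) (X a)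
    have h2 := Matrix.posSemidef_gram ℂ (X a ∘ fun k => x k a)
    have hc : (0 : ℝ) ≤ ∏ n ∈ s, ‖X n‖ ^ 2 := Finset.prod_nonneg fun _ _ => by positivity
    have h3 : ((∏ n ∈ s, ‖X n‖ ^ 2) • prodGram s x).PosSemidef :=
      (posSemidef_prodGram s x).smul hc
    have h4 := (h1.hadamard h3).add (h2.hadamard ih)
    have e : (∏ n ∈ insert a s, ‖X n‖ ^ 2) • prodGram (insert a s) x -
        (prodGram (insert a s) fun k n => X n (x k n)) =
        Matrix.hadamard (‖X a‖ ^ 2 • Matrix.gram ℂ (fun k => x k a) -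
            Matrix.gram ℂ (X a ∘ fun k => x k a))
          ((∏ n ∈ s, ‖X n‖ ^ 2) • prodGram s x) +
        Matrix.hadamard (Matrix.gram ℂ (X a ∘ fun k => x k a))
          ((∏ n ∈ s, ‖X n‖ ^ 2) • prodGram s x - prodGram s fun k n => X n (x k n)) := by
      ext k j
      simp [prodGram, Finset.prod_insert ha]
      ring
    rw [e]
    exact h4

variable [Fintype ι]

/-- The linear functional `⊗ₙ y n ↦ ∏ₙ ⟪x n, y n⟫`. -/
def tmulFunctional (x : ∀ n, H n) : AlgTensor H →ₗ[ℂ] ℂ :=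
  algLift
    ((MultilinearMap.mkPiAlgebra ℂ ι ℂ).compLinearMap fun n => (innerSL ℂ (x n)).toLinearMap)

theorem tmulFunctional_algTmul (x y : ∀ n, H n) :
    tmulFunctional x (algTmul y) = ∏ n, ⟪x n, y n⟫_ℂ :=
  algLift_algTmul _ y

/-- For fixed `t`, the map `x ↦ conj (⟪⊗ₙ x n, t⟫)` is multilinear. -/
def conjInnerMultilinear (t : AlgTensor H) : MultilinearMap ℂ H ℂ where
  toFun x := conj (tmulFunctional x t)
  map_update_add' x i u v := by
    obtain ⟨m, c, y, rfl⟩ := exists_eq_sum t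
    simp only [map_sum, map_smul, tmulFunctional_algTmul, smul_eq_mul, map_mul, map_prod,
      inner_conj_symm, ← Finset.sum_add_distrib]
    refine Finset.sum_congr rfl fun k _ => ?_
    rw [← mul_add]
    congr 1
    have := (MultilinearMap.mkPiAlgebra ℂ ι ℂ).compLinearMap
      (fun n => (innerSL ℂ (y k n)).toLinearMap) |>.map_update_add x i u v
    exact this
  map_update_smul' x i a u := by
    obtain ⟨m, c, y, rfl⟩ := exists_eq_sum t
    simp only [map_sum, map_smul, tmulFunctional_algTmul, smul_eq_mul, map_mul, map_prod,
      inner_conj_symm, Finset.mul_sum]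
    refine Finset.sum_congr rfl fun k _ => ?_
    rw [mul_left_comm]
    congr 1
    have := (MultilinearMap.mkPiAlgebra ℂ ι ℂ).compLinearMap
      (fun n => (innerSL ℂ (y k n)).toLinearMap) |>.map_update_smul x i a u
    exact this

/-- The inner product on the algebraic tensor product: the sesquilinear form determined by
`⟪⊗ₙ x n, ⊗ₙ y n⟫ = ∏ₙ ⟪x n, y n⟫`. -/
def algInner (s t : AlgTensor H) : ℂ :=
  conj (algLift (conjInnerMultilinear t) s)

theorem algInner_add_left (s s' t : AlgTensor H) :
    algInner (s + s') t = algInner s t + algInner s' t := by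
  simp [algInner]

theorem algInner_smul_left (s t : AlgTensor H) (a : ℂ) :
    algInner (a • s) t = conj a * algInner s t := by
  simp [algInner]

theorem algInner_sum_left {m : ℕ} (s : Fin m → AlgTensor H) (t : AlgTensor H) :
    algInner (∑ k, s k) t = ∑ k, algInner (s k) t := by
  simp [algInner]

theorem algInner_algTmul_left (x : ∀ n, H n) (t : AlgTensor H) :
    algInner (algTmul x) t = tmulFunctional x t := by
  unfold algInner
  rw [algLift_algTmul]
  exact Complex.conj_conj _

theorem algInner_sum_sum {m l : ℕ} (c : Fin m → ℂ) (d : Fin l → ℂ) (x : Fin m → ∀ n, H n)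
    (y : Fin l → ∀ n, H n) :
    algInner (∑ k, c k • algTmul (x k)) (∑ j, d j • algTmul (y j)) =
      ∑ k, ∑ j, conj (c k) * (d j * ∏ n, ⟪x k n, y j n⟫_ℂ) := by
  simp only [algInner_sum_left, algInner_smul_left, algInner_algTmul_left, map_sum, map_smul,
    tmulFunctional_algTmul, smul_eq_mul, Finset.mul_sum]

theorem algInner_self_eq {m : ℕ} (c : Fin m → ℂ) (x : Fin m → ∀ n, H n) :
    algInner (∑ k, c k • algTmul (x k)) (∑ k, c k • algTmul (x k)) =
      star c ⬝ᵥ (prodGram Finset.univ x *ᵥ c) := by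
  rw [algInner_sum_sum]
  simp only [dotProduct, Matrix.mulVec, prodGram, Matrix.of_apply, Finset.mul_sum, Pi.star_apply]
  refine Finset.sum_congr rfl fun k _ => Finset.sum_congr rfl fun j _ => ?_
  rw [mul_comm (c j)]
  rfl

variable (H) in
/-- The pre-inner product structure on the algebraic tensor product. -/
@[reducible] def algTensorCore : PreInnerProductSpace.Core ℂ (AlgTensor H) where
  inner := algInner
  conj_inner_symm s t := by
    obtain ⟨m, c, x, rfl⟩ := exists_eq_sum s
    obtain ⟨l, d, y, rfl⟩ := exists_eq_sum t
    rw [algInner_sum_sum, algInner_sum_sum, Finset.sum_comm]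
    simp only [map_sum, map_mul, map_prod, inner_conj_symm, Complex.conj_conj]
    refine Finset.sum_congr rfl fun k _ => Finset.sum_congr rfl fun j _ => ?_
    ring
  re_inner_nonneg t := by
    obtain ⟨m, c, x, rfl⟩ := exists_eq_sum t
    rw [algInner_self_eq]
    exact (Complex.le_def.1 ((posSemidef_prodGram _ x).dotProduct_mulVec_nonneg c)).1
  add_left := algInner_add_left
  smul_left s t a := algInner_smul_left s t a

instance : SeminormedAddCommGroup (AlgTensor H) :=
  @InnerProductSpace.Core.toSeminormedAddCommGroup ℂ _ _ _ _ (algTensorCore H)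

instance : InnerProductSpace ℂ (AlgTensor H) := InnerProductSpace.ofCore (algTensorCore H)

theorem inner_eq_algInner (s t : AlgTensor H) : ⟪s, t⟫_ℂ = algInner s t := rfl

theorem inner_algTmul (x y : ∀ n, H n) :
    ⟪algTmul x, algTmul y⟫_ℂ = ∏ n, ⟪x n, y n⟫_ℂ := by
  rw [inner_eq_algInner, algInner_algTmul_left, tmulFunctional_algTmul]

variable (H) in
/-- The Hilbert space tensor product of the Hilbert spaces `H n`: the completion of the algebraic
tensor product for the inner product `⟪⊗ₙ x n, ⊗ₙ y n⟫ = ∏ₙ ⟪x n, y n⟫`. -/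
abbrev HilbertTensor : Type _ := UniformSpace.Completion (AlgTensor H)

theorem norm_algTensorMap_le (X : ∀ n, H n →L[ℂ] H n) (t : AlgTensor H) :
    ‖algTensorMap X t‖ ≤ (∏ n, ‖X n‖) * ‖t‖ := by
  have hc : (0 : ℝ) ≤ ∏ n, ‖X n‖ := Finset.prod_nonneg fun _ _ => norm_nonneg _
  refine le_of_sq_le_sq ?_ (mul_nonneg hc (norm_nonneg _))
  obtain ⟨m, c, x, rfl⟩ := exists_eq_sum t
  have h := (posSemidef_prodGram_sub X Finset.univ x).dotProduct_mulVec_nonneg c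
  rw [Matrix.sub_mulVec, Matrix.smul_mulVec, dotProduct_sub, dotProduct_smul, ← algInner_self_eq,
    ← algInner_self_eq, ← inner_eq_algInner, ← inner_eq_algInner] at h
  simp only [map_sum, map_smul, algTensorMap_algTmul]
  have h' := (Complex.le_def.1 h).1
  rw [inner_self_eq_norm_sq_to_K, inner_self_eq_norm_sq_to_K, Complex.zero_re, Complex.sub_re,
    Complex.smul_re] at h'
  norm_cast at h'
  rw [mul_pow, ← Finset.prod_pow]
  rw [smul_eq_mul, sub_nonneg] at h'
  exact_mod_cast h'

/-- The tensor product `⊗ₙ X n` of bounded operators, a bounded operator on the Hilbert space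
tensor product. -/
def tensorOp (X : ∀ n, H n →L[ℂ] H n) : HilbertTensor H →L[ℂ] HilbertTensor H :=
  ((algTensorMap X).mkContinuous (∏ n, ‖X n‖) (norm_algTensorMap_le X)).completion

/-- The elementary tensor `⊗ₙ x n` in the Hilbert space tensor product. -/
def tmul (x : ∀ n, H n) : HilbertTensor H := (algTmul x : AlgTensor H)

theorem tensorOp_tmul (X : ∀ n, H n →L[ℂ] H n) (x : ∀ n, H n) :
    tensorOp X (tmul x) = tmul fun n => X n (x n) := by
  unfold tensorOp tmul
  rw [ContinuousLinearMap.completion_apply_coe]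
  simp [algTensorMap_algTmul]

end HilbertTensorProduct

section Quantum

open scoped InnerProductSpace

variable {K : Type*} [NormedAddCommGroup K] [InnerProductSpace ℂ K] [CompleteSpace K]

variable (K) in
/-- The index set of a fixed orthonormal (Hilbert) basis of `K`. -/
def basisIndex : Set K := (exists_hilbertBasis ℂ K).choose

variable (K) in
/-- A fixed orthonormal (Hilbert) basis of `K`. -/
def basis : HilbertBasis (basisIndex K) ℂ K := (exists_hilbertBasis ℂ K).choose_spec.choose

/-- The trace `∑ᵢ ⟪eᵢ, T eᵢ⟫`. For a trace class operator the series converges absolutely and does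
not depend on the orthonormal basis; below it is only applied to operators `ρ ∘ X` with `ρ` a
density operator and `X` bounded, which are trace class. -/
def trace (T : K →L[ℂ] K) : ℂ := ∑' i, ⟪basis K i, T (basis K i)⟫_ℂ

/-- A quantum state (density operator): a positive trace class operator of trace one. For a
positive operator, being trace class means that `∑ᵢ ⟪eᵢ, ρ eᵢ⟫` converges. -/
def IsQuantumState (ρ : K →L[ℂ] K) : Prop :=
  ρ.IsPositive ∧ HasSum (fun i => ⟪basis K i, ρ (basis K i)⟫_ℂ) 1

/-- A normalized positive operator-valued measure on the measurable space `Λ` with values in the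
bounded operators on `K`, countably additive in the weak operator topology. -/
structure POVM (K : Type*) [NormedAddCommGroup K] [InnerProductSpace ℂ K] [CompleteSpace K]
    (Λ : Type*) [MeasurableSpace Λ] where
  /-- the operator assigned to a set -/
  toFun : Set Λ → K →L[ℂ] K
  isPositive : ∀ F, MeasurableSet F → (toFun F).IsPositive
  map_univ : toFun Set.univ = ContinuousLinearMap.id ℂ K
  hasSum_iUnion : ∀ F : ℕ → Set Λ, (∀ k, MeasurableSet (F k)) → Pairwise (Function.onFun Disjoint F) →
    ∀ x y : K, HasSum (fun k => ⟪x, toFun (F k) y⟫_ℂ) ⟪x, toFun (⋃ k, F k) y⟫_ℂ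

end Quantum

section Scenario

open MeasureTheory ProbabilityTheory

variable {N : ℕ} (S : Fin N → ℕ) (Λ : Fin N → Type*) [∀ n, MeasurableSpace (Λ n)]

/-- An `S₁ × ⋯ × S_N`-setting correlation scenario: one joint probability distribution on
`Λ₁ × ⋯ × Λ_N` for every tuple `(s₁, …, s_N)` of measurement settings. -/
abbrev Scenario : Type _ := (∀ n, Fin (S n)) → ProbabilityMeasure (∀ n, Λ n)

/-- A family `Ψ` of bounded measurable real functions `ψ_(s₁, …, s_N)` on `Λ₁ × ⋯ × Λ_N`. -/
structure FunctionFamily where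
  /-- the function belonging to a tuple of settings -/
  toFun : (∀ n, Fin (S n)) → (∀ n, Λ n) → ℝ
  measurable : ∀ s, Measurable (toFun s)
  bounded : ∀ s, ∃ C : ℝ, ∀ l, |toFun s l| ≤ C

variable {S Λ}

/-- The linear combination of averages `∑_s ⟨ψ_s⟩` in the scenario `P`. -/
def averageSum (Ψ : FunctionFamily S Λ) (P : Scenario S Λ) : ℝ :=
  ∑ s, ∫ l, Ψ.toFun s l ∂(P s : Measure (∀ n, Λ n))

/-- The scenario `P` admits a local hidden variable model: with a probability space `(Ω, ν)` and
conditional probability distributions `κ n sₙ`,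
`P_s (F₁ × ⋯ × F_N) = ∫ ∏ₙ κ n sₙ (Fₙ | ω) ν(dω)`. -/
def IsLHV {Λ : Fin N → Type v} [∀ n, MeasurableSpace (Λ n)] (P : Scenario S Λ) : Prop :=
  ∃ (Ω : Type v) (_ : MeasurableSpace Ω) (ν : Measure Ω) (κ : ∀ n, Fin (S n) → Kernel Ω (Λ n)),
    IsProbabilityMeasure ν ∧ (∀ n i, IsMarkovKernel (κ n i)) ∧
    ∀ (s : ∀ n, Fin (S n)) (F : ∀ n, Set (Λ n)), (∀ n, MeasurableSet (F n)) →
      (P s : Measure (∀ n, Λ n)) (Set.univ.pi F) = ∫⁻ ω, ∏ n, κ n (s n) ω (F n) ∂ν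

/-- The values of `∑_s ⟨ψ_s⟩` over all LHV scenarios. -/
def lhvValues (Ψ : FunctionFamily S Λ) : Set ℝ :=
  {x | ∃ P : Scenario S Λ, IsLHV P ∧ x = averageSum Ψ P}

/-- The LHV constant `B_Ψ = max {|sup|, |inf|}`, with supremum and infimum of `∑_s ⟨ψ_s⟩` over all
LHV scenarios. -/
def bellConst (Ψ : FunctionFamily S Λ) : ℝ :=
  max |sSup (lhvValues Ψ)| |sInf (lhvValues Ψ)|

/-- The projection `Λ₁^{S₁} × ⋯ × Λ_N^{S_N} → Λ₁ × ⋯ × Λ_N` onto the coordinates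
`(1, s₁), …, (N, s_N)`. -/
def settingProj (s : ∀ n, Fin (S n)) (w : ∀ n, Fin (S n) → Λ n) : ∀ n, Λ n := fun n => w n (s n)

/-- `μ` is a normalized bounded real-valued measure on `Λ₁^{S₁} × ⋯ × Λ_N^{S_N}` returning all
distributions of the scenario `P` as marginals. -/
def Simulates (μ : SignedMeasure (∀ n, Fin (S n) → Λ n)) (P : Scenario S Λ) : Prop :=
  μ Set.univ = 1 ∧
    ∀ s, μ.map (settingProj s) = (P s : Measure (∀ n, Λ n)).toSignedMeasure

/-- The scenario parameter `γ`: the infimum of the total variation norms of the normalized bounded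
real-valued measures that return all distributions of the scenario as marginals. -/
def scenarioParam (P : Scenario S Λ) : ENNReal :=
  ⨅ (μ : SignedMeasure (∀ n, Fin (S n) → Λ n)) (_ : Simulates μ P), μ.totalVariation Set.univ

variable {H : Fin N → Type*} [∀ n, NormedAddCommGroup (H n)] [∀ n, InnerProductSpace ℂ (H n)]
  [∀ n, CompleteSpace (H n)]

/-- `P` is the quantum scenario generated by the state `ρ` and the POV measures `M n sₙ`:
`P_s (F₁ × ⋯ × F_N) = tr[ρ {M₁^(s₁)(F₁) ⊗ ⋯ ⊗ M_N^(s_N)(F_N)}]`. Rectangles generate the product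
`σ`-algebra, so `P` is unique; on standard Borel spaces it exists for all `M`. -/
def IsQuantumScenario (ρ : HilbertTensor H →L[ℂ] HilbertTensor H)
    (M : ∀ n, Fin (S n) → POVM (H n) (Λ n)) (P : Scenario S Λ) : Prop :=
  ∀ (s : ∀ n, Fin (S n)) (F : ∀ n, Set (Λ n)), (∀ n, MeasurableSet (F n)) →
    (((P s : Measure (∀ n, Λ n)).real (Set.univ.pi F) : ℝ) : ℂ) =
      trace (ρ ∘L tensorOp fun n => (M n (s n)).toFun (F n))

variable (S Λ) in
/-- The state parameter `Υ^{(ρ,Λ)}_{S₁ × ⋯ × S_N}`: the supremum of the scenario parameter over all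
quantum scenarios generated by `ρ` and POV measures with outcomes in `Λ`. -/
def stateParam (ρ : HilbertTensor H →L[ℂ] HilbertTensor H) : ENNReal :=
  ⨆ (M : ∀ n, Fin (S n) → POVM (H n) (Λ n)) (P : Scenario S Λ) (_ : IsQuantumScenario ρ M P),
    scenarioParam P

end Scenario

end BellViolation

end

/-! Both sides are suprema over the same quantum scenarios, so it suffices to prove, for a single
scenario $P$, that $\gamma$ equals the supremum of its Bell violations (`scenarioParam_eq_iSup`).
The constant $\mathcal B_\Psi$ is tied to the sup norm of $\sum_s \psi_s\circ\pi_s$ on $\prod_n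
\Lambda_n^{S_n}$: deterministic scenarios are LHV, and every LHV scenario consists of the marginals
of one probability measure there (`abs_bellFun_le_bellConst`, `bellConst_le`). Integrating this
function against a simulating signed measure $\mu$ gives $|\sum_s\langle\psi_s\rangle| \le \mathcal
B_\Psi\,\|\mu\|_{var}$, hence violation $\le\gamma$. The converse is Hahn–Banach duality. If all
violations are at most $C$, the functional $(\psi_s)\mapsto\sum_s\langle\psi_s\rangle$ is bounded by
$C$ times that sup norm. Embedding each $\Lambda_n$ measurably in Cantor space gives a compact
space, where the functional on continuous families extends and Riesz representation yields positive
measures $\mu_1,\mu_2$ of total mass at most $C$. Their difference, pulled back to the $\Lambda_n$,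
simulates $P$ (`exists_measures_of_abs_le`, `exists_simulates_totalVariation_le`). -/

namespace BellViolation

section Duality

open MeasureTheory ProbabilityTheory


/-! ### Hahn–Banach extension and Riesz representation -/

/-- A positive linear functional on `C(X, ℝ)`, `X` compact Hausdorff, is integration against a
finite measure. -/
theorem exists_measure_of_positive_functional {X : Type*} [TopologicalSpace X] [CompactSpace X]
    [T2Space X] [MeasurableSpace X] [BorelSpace X] (F : C(X, ℝ) →ₗ[ℝ] ℝ)
    (hF : ∀ f, 0 ≤ f → 0 ≤ F f) :
    ∃ μ : Measure X, IsFiniteMeasure μ ∧ ∀ f : C(X, ℝ), ∫ x, f x ∂μ = F f := by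
  let Λ : CompactlySupportedContinuousMap X ℝ →ₚ[ℝ] ℝ :=
    { toFun := fun g => F g.toContinuousMap
      map_add' := fun g g' => F.map_add g.toContinuousMap g'.toContinuousMap
      map_smul' := fun c g => F.map_smul c g.toContinuousMap
      monotone' := fun g g' h => by
        have := hF (g'.toContinuousMap - g.toContinuousMap)
          (fun x => sub_nonneg.2 (h x))
        rw [map_sub] at this
        exact sub_nonneg.1 this }
  refine ⟨RealRMK.rieszMeasure Λ, inferInstance, fun f => ?_⟩
  exact RealRMK.integral_rieszMeasure Λ ⟨f, HasCompactSupport.of_compactSpace _⟩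

/-- A linear functional bounded by `C` times the sup norm of an image in `C(X, ℝ)` is represented
by a difference of two finite measures of total mass at most `C`. -/
theorem exists_measures_of_abs_le {X G : Type*} [TopologicalSpace X] [CompactSpace X]
    [T2Space X] [MeasurableSpace X] [BorelSpace X] [AddCommGroup G] [Module ℝ G]
    (T : G →ₗ[ℝ] C(X, ℝ)) (L : G →ₗ[ℝ] ℝ) {C : ℝ} (hC : 0 ≤ C)
    (h : ∀ g, |L g| ≤ C * ‖T g‖) :
    ∃ μ₁ μ₂ : Measure X, IsFiniteMeasure μ₁ ∧ IsFiniteMeasure μ₂ ∧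
      μ₁.real Set.univ + μ₂.real Set.univ ≤ C ∧
      ∀ g, ∫ x, T g x ∂μ₁ - ∫ x, T g x ∂μ₂ = L g := by
  -- Doubling to pairs $(f,-f)$ lets one extension produce both measures as positive functionals, so
  -- no Jordan decomposition of a dual element is needed.
  let T' : G →ₗ[ℝ] C(X, ℝ) × C(X, ℝ) := T.prod (-T)
  -- A linear section `r` descends `L` to the range: by `h`, `L` vanishes on the kernel of `T`, so
  -- the choice of preimage is immaterial.
  obtain ⟨r, hr⟩ := T'.rangeRestrict.exists_rightInverse_of_surjective T'.range_rangeRestrict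
  have hLr : ∀ g, L (r (T'.rangeRestrict g)) = L g := by
    intro g
    have h1 : T'.rangeRestrict (r (T'.rangeRestrict g)) = T'.rangeRestrict g :=
      LinearMap.congr_fun hr _
    have h2 : T (r (T'.rangeRestrict g)) = T g := congrArg (fun z => z.1.1) h1
    have h3 := h (r (T'.rangeRestrict g) - g)
    rw [map_sub, map_sub, h2, sub_self, norm_zero, mul_zero] at h3
    exact sub_eq_zero.1 (abs_nonpos_iff.1 h3)
  have posPart_add : ∀ f g : C(X, ℝ), ‖(f + g) ⊔ 0‖ ≤ ‖f ⊔ 0‖ + ‖g ⊔ 0‖ := by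
    intro f g
    refine le_trans ?_ (norm_add_le _ _)
    rw [ContinuousMap.norm_le _ (norm_nonneg _)]
    intro x
    refine le_trans ?_ ((f ⊔ 0 + g ⊔ 0).norm_coe_le_norm x)
    simp only [ContinuousMap.sup_apply, ContinuousMap.zero_apply, Real.norm_eq_abs,
      ContinuousMap.add_apply]
    rw [abs_of_nonneg le_sup_right, abs_of_nonneg (add_nonneg le_sup_right le_sup_right)]
    exact sup_le (add_le_add le_sup_left le_sup_left) (add_nonneg le_sup_right le_sup_right)
  have posPart_smul : ∀ (c : ℝ), 0 < c → ∀ f : C(X, ℝ), ‖(c • f) ⊔ 0‖ = c * ‖f ⊔ 0‖ := by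
    intro c hc f
    have : (c • f) ⊔ 0 = c • (f ⊔ 0) := by
      ext x
      simp only [ContinuousMap.sup_apply, ContinuousMap.zero_apply, ContinuousMap.smul_apply,
        smul_eq_mul]
      rw [mul_max_of_nonneg _ _ hc.le, mul_zero]
    rw [this, norm_smul, Real.norm_eq_abs, abs_of_pos hc]
  -- The majorant uses only positive parts. At $(f,-f)$ it equals $C\|f\|$, so it dominates `L`; it
  -- vanishes at nonpositive pairs, which forces `F` to be positive.
  obtain ⟨F, hF, hFle⟩ := exists_extension_of_le_sublinear
    (⟨LinearMap.range T', L ∘ₗ r⟩ : (C(X, ℝ) × C(X, ℝ)) →ₗ.[ℝ] ℝ)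
    (fun z => C * (‖z.1 ⊔ 0‖ ⊔ ‖z.2 ⊔ 0‖))
    (fun c hc z => by
      simp only [Prod.smul_fst, Prod.smul_snd, posPart_smul c hc]
      rw [← mul_max_of_nonneg _ _ hc.le]
      ring)
    (fun y z => by
      rw [← mul_add]
      refine mul_le_mul_of_nonneg_left ?_ hC
      exact sup_le ((posPart_add _ _).trans (add_le_add le_sup_left le_sup_left))
        ((posPart_add _ _).trans (add_le_add le_sup_right le_sup_right)))
    (by
      rintro ⟨_, g, rfl⟩
      change L (r (T'.rangeRestrict g)) ≤ C * (‖T g ⊔ 0‖ ⊔ ‖(-T g) ⊔ 0‖)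
      rw [hLr]
      refine (le_abs_self _).trans ((h g).trans (mul_le_mul_of_nonneg_left ?_ hC))
      rw [ContinuousMap.norm_le _ (le_sup_of_le_left (norm_nonneg _))]
      intro x
      rw [Real.norm_eq_abs]
      rcases le_total 0 (T g x) with hx | hx
      · rw [abs_of_nonneg hx]
        refine le_sup_of_le_left ?_
        exact (le_sup_left.trans (le_abs_self _)).trans ((T g ⊔ 0).norm_coe_le_norm x)
      · rw [abs_of_nonpos hx]
        refine le_sup_of_le_right ?_
        exact (le_sup_left.trans (le_abs_self _)).trans ((-T g ⊔ 0).norm_coe_le_norm x))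
  have hFT : ∀ g, F (T g, -T g) = L g := fun g => by
    rw [← hLr g]
    exact hF (T'.rangeRestrict g)
  have hpos : ∀ z : C(X, ℝ) × C(X, ℝ), 0 ≤ z → 0 ≤ F z := by
    intro z hz
    have h1 := hFle (-z)
    have e1 : (-z).1 ⊔ 0 = 0 := sup_eq_right.2 (neg_nonpos.2 hz.1)
    have e2 : (-z).2 ⊔ 0 = 0 := sup_eq_right.2 (neg_nonpos.2 hz.2)
    simp only [e1, e2, norm_zero, sup_idem, mul_zero, map_neg] at h1
    exact neg_nonpos.1 h1
  obtain ⟨μ₁, hμ₁, h₁⟩ := exists_measure_of_positive_functional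
    (F ∘ₗ LinearMap.inl ℝ _ _) (fun f hf => hpos _ ⟨hf, le_rfl⟩)
  obtain ⟨μ₂, hμ₂, h₂⟩ := exists_measure_of_positive_functional
    (F ∘ₗ LinearMap.inr ℝ _ _) (fun f hf => hpos _ ⟨le_rfl, hf⟩)
  refine ⟨μ₁, μ₂, hμ₁, hμ₂, ?_, fun g => ?_⟩
  -- The two masses add up to $F(1,1)$, where the majorant is at most $C$; bounding them separately
  -- would only give $2C$.
  · have e1 : μ₁.real Set.univ = F (1, 0) := by simpa using h₁ 1
    have e2 : μ₂.real Set.univ = F (0, 1) := by simpa using h₂ 1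
    rw [e1, e2, ← map_add]
    refine (hFle _).trans ?_
    have : ‖(1 : C(X, ℝ)) ⊔ 0‖ ≤ 1 := by
      rw [ContinuousMap.norm_le _ zero_le_one]
      intro x
      simp
    simp only [Prod.mk_add_mk, add_zero, zero_add, sup_idem]
    exact mul_le_of_le_one_right hC this
  · rw [h₁, h₂, ← hFT g, LinearMap.comp_apply, LinearMap.comp_apply, ← map_sub]
    simp

/-! ### Bell functions and simulating signed measures -/

section Violation


variable {N : ℕ} {S : Fin N → ℕ} {Λ : Fin N → Type*} [∀ n, MeasurableSpace (Λ n)]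

theorem measurable_settingProj (s : ∀ n, Fin (S n)) :
    Measurable (settingProj (Λ := Λ) s) := by
  unfold settingProj
  fun_prop

/-- The function `∑_s ψ_s ∘ π_s` on `Λ₁^{S₁} × ⋯ × Λ_N^{S_N}`. -/
noncomputable def bellFun (Ψ : FunctionFamily S Λ) (w : ∀ n, Fin (S n) → Λ n) : ℝ :=
  ∑ s, Ψ.toFun s (settingProj s w)

theorem FunctionFamily.integrable (Ψ : FunctionFamily S Λ) (s : ∀ n, Fin (S n))
    (μ : Measure (∀ n, Λ n)) [IsFiniteMeasure μ] : Integrable (Ψ.toFun s) μ := by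
  obtain ⟨C, hC⟩ := Ψ.bounded s
  exact Integrable.of_bound (Ψ.measurable s).aestronglyMeasurable C (ae_of_all _ hC)

theorem exists_abs_bellFun_le (Ψ : FunctionFamily S Λ) :
    ∃ R, 0 ≤ R ∧ ∀ w, |bellFun Ψ w| ≤ R := by
  choose C hC using Ψ.bounded
  refine ⟨∑ s, |C s|, Finset.sum_nonneg fun _ _ => abs_nonneg _, fun w => ?_⟩
  exact (Finset.abs_sum_le_sum_abs _ _).trans
    (Finset.sum_le_sum fun s _ => (hC s _).trans (le_abs_self _))

theorem integral_bellFun (Ψ : FunctionFamily S Λ) (μ : Measure (∀ n, Fin (S n) → Λ n))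
    [IsFiniteMeasure μ] :
    ∫ w, bellFun Ψ w ∂μ = ∑ s, ∫ l, Ψ.toFun s l ∂(μ.map (settingProj s)) := by
  unfold bellFun
  rw [integral_finsetSum]
  · refine Finset.sum_congr rfl fun s _ => ?_
    rw [integral_map (measurable_settingProj s).aemeasurable
      (Ψ.measurable s).aestronglyMeasurable]
  · intro s _
    exact (Ψ.integrable s (μ.map (settingProj s))).comp_measurable (measurable_settingProj s)

theorem abs_integral_bellFun_le (Ψ : FunctionFamily S Λ) (μ : Measure (∀ n, Fin (S n) → Λ n))
    [IsFiniteMeasure μ] {R : ℝ} (hR : ∀ w, |bellFun Ψ w| ≤ R) :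
    |∫ w, bellFun Ψ w ∂μ| ≤ R * μ.real Set.univ :=
  norm_integral_le_of_norm_le_const (f := bellFun Ψ) (C := R) (ae_of_all _ hR)

/-- If the marginals of `μ₁ - μ₂` are the distributions of `P`, then the average of `Ψ` in `P` is
the integral of `∑_s ψ_s ∘ π_s` against `μ₁ - μ₂`. -/
theorem averageSum_eq_sub (Ψ : FunctionFamily S Λ) {P : Scenario S Λ}
    {μ₁ μ₂ : Measure (∀ n, Fin (S n) → Λ n)} [IsFiniteMeasure μ₁] [IsFiniteMeasure μ₂]
    (h : ∀ s, μ₁.map (settingProj s) = μ₂.map (settingProj s) + (P s : Measure (∀ n, Λ n))) :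
    averageSum Ψ P = ∫ w, bellFun Ψ w ∂μ₁ - ∫ w, bellFun Ψ w ∂μ₂ := by
  rw [integral_bellFun, integral_bellFun, averageSum, ← Finset.sum_sub_distrib]
  refine Finset.sum_congr rfl fun s _ => ?_
  rw [h s, integral_add_measure (Ψ.integrable s _) (Ψ.integrable s _), add_sub_cancel_left]

/-- The Jordan parts of $\mu$ have marginals differing by $P_s$, so the average is a difference of
two integrals of `bellFun Ψ`; the masses of the parts add up to the total variation. -/
theorem Simulates.abs_averageSum_le {μ : SignedMeasure (∀ n, Fin (S n) → Λ n)}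
    {P : Scenario S Λ} (hμ : Simulates μ P) (Ψ : FunctionFamily S Λ) {R : ℝ}
    (hR : ∀ w, |bellFun Ψ w| ≤ R) :
    |averageSum Ψ P| ≤ R * μ.totalVariation.real Set.univ := by
  have h : ∀ s, μ.toJordanDecomposition.posPart.map (settingProj s) =
      μ.toJordanDecomposition.negPart.map (settingProj s) + (P s : Measure (∀ n, Λ n)) := by
    intro s
    ext F hF
    rw [← measureReal_eq_measureReal_iff, measureReal_add_apply,
      map_measureReal_apply (measurable_settingProj s) hF,
      map_measureReal_apply (measurable_settingProj s) hF, ← sub_eq_iff_eq_add',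
      ← μ.apply_eq_posPart_real_sub_negPart_real (measurable_settingProj s hF),
      ← VectorMeasure.map_apply _ (measurable_settingProj s) hF, hμ.2 s,
      Measure.toSignedMeasure_apply_measurable hF]
  rw [averageSum_eq_sub Ψ h, SignedMeasure.totalVariation, measureReal_add_apply, mul_add]
  exact (abs_sub _ _).trans
    (add_le_add (abs_integral_bellFun_le Ψ _ hR) (abs_integral_bellFun_le Ψ _ hR))

/-- Measures on a finite product agree if they agree on boxes. -/
theorem ext_of_pi {ι : Type*} [Finite ι] {X : ι → Type*} [∀ i, MeasurableSpace (X i)]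
    {μ ν : Measure (∀ i, X i)} [IsFiniteMeasure μ]
    (h : ∀ F : ∀ i, Set (X i), (∀ i, MeasurableSet (F i)) →
      μ (Set.univ.pi F) = ν (Set.univ.pi F)) : μ = ν := by
  refine ext_of_generate_finite _ generateFrom_pi.symm isPiSystem_pi ?_ ?_
  · rintro _ ⟨F, hF, rfl⟩
    exact h F fun i => hF i trivial
  · simpa using h (fun _ => Set.univ) fun _ => MeasurableSet.univ

/-- A finite product of probability measures depending measurably on a parameter is measurable in
the parameter. -/
theorem measurable_measure_pi {ι Ω : Type*} [Fintype ι] [MeasurableSpace Ω] {X : ι → Type*}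
    [∀ i, MeasurableSpace (X i)] (κ : ∀ i, Ω → Measure (X i)) (hκ : ∀ i, Measurable (κ i))
    [∀ i ω, IsProbabilityMeasure (κ i ω)] :
    Measurable fun ω => Measure.pi fun i => κ i ω := by
  refine Measurable.measure_of_isPiSystem_of_isProbabilityMeasure generateFrom_pi.symm
    isPiSystem_pi ?_
  rintro _ ⟨F, hF, rfl⟩
  simp only [Measure.pi_pi]
  exact Finset.measurable_prod _ fun i _ =>
    (Measure.measurable_coe (hF i trivial)).comp (hκ i)

theorem pi_pi_map_settingProj (κ : ∀ n, Fin (S n) → Measure (Λ n))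
    [∀ n i, IsProbabilityMeasure (κ n i)] (s : ∀ n, Fin (S n)) :
    (Measure.pi fun n => Measure.pi (κ n)).map (settingProj s) =
      Measure.pi fun n => κ n (s n) := by
  have (n : Fin N) : IsFiniteMeasure ((Measure.pi (κ n)).map fun w => w (s n)) := inferInstance
  have h := Measure.pi_map_pi (μ := fun n => Measure.pi (κ n))
    (f := fun n (w : Fin (S n) → Λ n) => w (s n))
    (fun n => (measurable_pi_apply (s n)).aemeasurable)
  refine Eq.trans h ?_
  congr 1
  ext1 n
  exact (measurePreserving_eval (κ n) (s n)).map_eq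

/-! ### LHV models and the sup norm of the Bell function -/

section LHV

variable {Λ : Fin N → Type v} [∀ n, MeasurableSpace (Λ n)]

/-- The distributions of an LHV scenario are the marginals of one probability measure. -/
theorem IsLHV.exists_joint {P : Scenario S Λ} (hP : IsLHV P) :
    ∃ τ : Measure (∀ n, Fin (S n) → Λ n), IsProbabilityMeasure τ ∧
      ∀ s, τ.map (settingProj s) = (P s : Measure (∀ n, Λ n)) := by
  obtain ⟨Ω, mΩ, ν, κ, hν, hκ, h⟩ := hP
  -- Given $\omega$, outcomes for all settings at all sites are drawn independently. Mixing over
  -- $\nu$ gives the joint measure.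
  let η : Kernel Ω (∀ n, Fin (S n) → Λ n) :=
    ⟨fun ω => Measure.pi fun n => Measure.pi fun i => κ n i ω,
      measurable_measure_pi (fun n ω => Measure.pi fun i => κ n i ω) fun n =>
        measurable_measure_pi (fun i ω => κ n i ω) fun i => (κ n i).measurable⟩
  have : IsMarkovKernel η := ⟨fun ω => by
    change IsProbabilityMeasure (Measure.pi fun n => Measure.pi fun i => κ n i ω)
    infer_instance⟩
  refine ⟨η ∘ₘ ν, inferInstance, fun s => ext_of_pi fun F hF => ?_⟩
  rw [h s F hF, Measure.map_apply (measurable_settingProj s) (MeasurableSet.univ_pi hF),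
    Measure.bind_apply (measurable_settingProj s (MeasurableSet.univ_pi hF)) η.aemeasurable]
  refine lintegral_congr fun ω => ?_
  rw [← Measure.map_apply (measurable_settingProj s) (MeasurableSet.univ_pi hF)]
  change (Measure.pi fun n => Measure.pi fun i => κ n i ω).map (settingProj s) _ = _
  rw [pi_pi_map_settingProj (fun n i => κ n i ω), Measure.pi_pi]

/-- The deterministic scenario with joint outcome `w`. -/
noncomputable def diracScenario (w : ∀ n, Fin (S n) → Λ n) : Scenario S Λ := fun s =>
  ⟨Measure.dirac (settingProj s w), inferInstance⟩

theorem isLHV_diracScenario (w : ∀ n, Fin (S n) → Λ n) : IsLHV (diracScenario w) := by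
  refine ⟨PUnit, inferInstance, Measure.dirac PUnit.unit,
    fun n i => Kernel.const _ (Measure.dirac (w n i)), inferInstance, fun n i => inferInstance,
    fun s F hF => ?_⟩
  rw [lintegral_dirac]
  change Measure.dirac (settingProj s w) _ = _
  classical
  simp only [Kernel.const_apply, Measure.dirac_apply' _ (MeasurableSet.univ_pi hF),
    Measure.dirac_apply' _ (hF _), Set.indicator_apply, Pi.one_apply, Finset.prod_ite_zero]
  simp [settingProj]

theorem averageSum_diracScenario (Ψ : FunctionFamily S Λ) (w : ∀ n, Fin (S n) → Λ n) :
    averageSum Ψ (diracScenario w) = bellFun Ψ w := by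
  refine Finset.sum_congr rfl fun s _ => ?_
  change ∫ l, Ψ.toFun s l ∂(Measure.dirac (settingProj s w)) = _
  exact integral_dirac' _ _ (Ψ.measurable s).stronglyMeasurable

theorem IsLHV.abs_averageSum_le {P : Scenario S Λ} (hP : IsLHV P) (Ψ : FunctionFamily S Λ)
    {R : ℝ} (hR : ∀ w, |bellFun Ψ w| ≤ R) : |averageSum Ψ P| ≤ R := by
  obtain ⟨τ, hτ, h⟩ := hP.exists_joint
  have h1 := averageSum_eq_sub Ψ (P := P) (μ₁ := τ) (μ₂ := 0) fun s => by simp [h s]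
  rw [h1, integral_zero_measure, sub_zero]
  simpa using abs_integral_bellFun_le Ψ τ hR

theorem bellConst_nonneg (Ψ : FunctionFamily S Λ) : 0 ≤ bellConst Ψ :=
  le_max_of_le_left (abs_nonneg _)

theorem bellConst_le (Ψ : FunctionFamily S Λ) {R : ℝ} (hR0 : 0 ≤ R)
    (hR : ∀ w, |bellFun Ψ w| ≤ R) : bellConst Ψ ≤ R := by
  have h : ∀ x ∈ lhvValues Ψ, |x| ≤ R := by
    rintro _ ⟨P, hP, rfl⟩
    exact hP.abs_averageSum_le Ψ hR
  unfold bellConst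
  rcases (lhvValues Ψ).eq_empty_or_nonempty with he | ⟨x, hx⟩
  -- Without LHV scenarios both `sSup` and `sInf` default to $0$, hence the assumption `hR0`.
  · simpa [he] using hR0
  · have hb : BddAbove (lhvValues Ψ) := ⟨R, fun y hy => (abs_le.1 (h y hy)).2⟩
    have hb' : BddBelow (lhvValues Ψ) := ⟨-R, fun y hy => (abs_le.1 (h y hy)).1⟩
    refine max_le (abs_le.2 ⟨?_, ?_⟩) (abs_le.2 ⟨?_, ?_⟩)
    · exact (abs_le.1 (h x hx)).1.trans (le_csSup hb hx)
    · exact csSup_le ⟨x, hx⟩ fun y hy => (abs_le.1 (h y hy)).2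
    · exact le_csInf ⟨x, hx⟩ fun y hy => (abs_le.1 (h y hy)).1
    · exact (csInf_le hb' hx).trans (abs_le.1 (h x hx)).2

/-- The value at `w` is the average in a deterministic LHV scenario. Boundedness of $\Psi$ makes the
real `sSup` and `sInf` genuine bounds. -/
theorem abs_bellFun_le_bellConst (Ψ : FunctionFamily S Λ) (w : ∀ n, Fin (S n) → Λ n) :
    |bellFun Ψ w| ≤ bellConst Ψ := by
  obtain ⟨R, -, hR⟩ := exists_abs_bellFun_le Ψ
  have h : ∀ x ∈ lhvValues Ψ, |x| ≤ R := by
    rintro _ ⟨P, hP, rfl⟩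
    exact hP.abs_averageSum_le Ψ hR
  have hb : BddAbove (lhvValues Ψ) := ⟨R, fun y hy => (abs_le.1 (h y hy)).2⟩
  have hb' : BddBelow (lhvValues Ψ) := ⟨-R, fun y hy => (abs_le.1 (h y hy)).1⟩
  have hx : bellFun Ψ w ∈ lhvValues Ψ :=
    ⟨_, isLHV_diracScenario w, (averageSum_diracScenario Ψ w).symm⟩
  refine abs_le.2 ⟨?_, ?_⟩
  · refine le_trans ?_ (csInf_le hb' hx)
    exact neg_le.1 ((neg_le_abs _).trans (le_max_right _ _))
  · exact (le_csSup hb hx).trans ((le_abs_self _).trans (le_max_left _ _))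

/-- Every Bell violation is at most the scenario parameter. -/
theorem ofReal_violation_le_scenarioParam (P : Scenario S Λ) (Ψ : FunctionFamily S Λ)
    (hΨ : bellConst Ψ ≠ 0) :
    ENNReal.ofReal |(bellConst Ψ)⁻¹ * averageSum Ψ P| ≤ scenarioParam P := by
  refine le_iInf₂ fun μ hμ => ?_
  rw [← ofReal_measureReal]
  refine ENNReal.ofReal_le_ofReal ?_
  have hpos : 0 < bellConst Ψ := (bellConst_nonneg Ψ).lt_of_ne' hΨ
  rw [abs_mul, abs_inv, abs_of_pos hpos, inv_mul_le_iff₀ hpos]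
  exact hμ.abs_averageSum_le Ψ (abs_bellFun_le_bellConst Ψ)

/-- The family `Ψ` with the constant `c` added to one of its functions. -/
def addConst (Ψ : FunctionFamily S Λ) (s₀ : ∀ n, Fin (S n)) (c : ℝ) : FunctionFamily S Λ where
  toFun s l := Ψ.toFun s l + Pi.single (M := fun _ => ℝ) s₀ c s
  measurable s := (Ψ.measurable s).add_const _
  bounded s := by
    obtain ⟨C, hC⟩ := Ψ.bounded s
    exact ⟨C + |Pi.single (M := fun _ => ℝ) s₀ c s|, fun l =>
      (abs_add_le _ _).trans (add_le_add_left (hC l) _)⟩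

theorem averageSum_addConst (Ψ : FunctionFamily S Λ) (s₀ : ∀ n, Fin (S n)) (c : ℝ)
    (P : Scenario S Λ) : averageSum (addConst Ψ s₀ c) P = averageSum Ψ P + c := by
  have : ∀ s, ∫ l, (addConst Ψ s₀ c).toFun s l ∂(P s : Measure (∀ n, Λ n)) =
      ∫ l, Ψ.toFun s l ∂(P s : Measure (∀ n, Λ n)) + Pi.single (M := fun _ => ℝ) s₀ c s := by
    intro s
    change ∫ l, (Ψ.toFun s l + Pi.single (M := fun _ => ℝ) s₀ c s)
      ∂(P s : Measure (∀ n, Λ n)) = _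
    rw [integral_add (Ψ.integrable s _) (integrable_const _)]
    simp
  unfold averageSum
  simp [this, Finset.sum_add_distrib]

theorem bellFun_addConst (Ψ : FunctionFamily S Λ) (s₀ : ∀ n, Fin (S n)) (c : ℝ)
    (w : ∀ n, Fin (S n) → Λ n) : bellFun (addConst Ψ s₀ c) w = bellFun Ψ w + c := by
  change ∑ s, (Ψ.toFun s (settingProj s w) + Pi.single (M := fun _ => ℝ) s₀ c s) = _
  rw [Finset.sum_add_distrib]
  simp [bellFun]

/-- A bound on all Bell violations bounds `∑_s ⟨ψ_s⟩` also for families with vanishing LHV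
constant. -/
theorem abs_averageSum_le_mul_bellConst [Nonempty (∀ n, Fin (S n) → Λ n)]
    (s₀ : ∀ n, Fin (S n)) {P : Scenario S Λ} {C : ℝ}
    (hC : ∀ Ψ : FunctionFamily S Λ, bellConst Ψ ≠ 0 →
      |(bellConst Ψ)⁻¹ * averageSum Ψ P| ≤ C) (Ψ : FunctionFamily S Λ) :
    |averageSum Ψ P| ≤ C * bellConst Ψ := by
  have key : ∀ Φ : FunctionFamily S Λ, bellConst Φ ≠ 0 →
      |averageSum Φ P| ≤ C * bellConst Φ := by
    intro Φ hΦ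
    have hpos : 0 < bellConst Φ := (bellConst_nonneg Φ).lt_of_ne' hΦ
    have := hC Φ hΦ
    rwa [abs_mul, abs_inv, abs_of_pos hpos, inv_mul_le_iff₀ hpos, mul_comm] at this
  by_cases h0 : bellConst Ψ = 0
  · have hf : ∀ w, bellFun Ψ w = 0 := fun w =>
      abs_nonpos_iff.1 ((abs_bellFun_le_bellConst Ψ w).trans_eq h0)
    -- When the Bell function vanishes identically, adding $c>0$ to one $\psi_s$ makes it the
    -- constant $c$, an admissible family; letting $c\to0$ then recovers the bound for $\Psi$.
    have hB : ∀ c : ℝ, 0 < c → bellConst (addConst Ψ s₀ c) = c := by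
      intro c hc
      refine le_antisymm (bellConst_le _ hc.le fun w => ?_) ?_
      · rw [bellFun_addConst, hf, zero_add, abs_of_pos hc]
      · obtain ⟨w⟩ := ‹Nonempty (∀ n, Fin (S n) → Λ n)›
        have := abs_bellFun_le_bellConst (addConst Ψ s₀ c) w
        rwa [bellFun_addConst, hf, zero_add, abs_of_pos hc] at this
    have hlim : ∀ c : ℝ, 0 < c → |averageSum Ψ P + c| ≤ C * c := by
      intro c hc
      have := key (addConst Ψ s₀ c) (by rw [hB c hc]; exact hc.ne')
      rwa [hB c hc, averageSum_addConst] at this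
    have hcont : |averageSum Ψ P + 0| ≤ C * 0 := by
      have h1 : Filter.Tendsto (fun c : ℝ => |averageSum Ψ P + c|) (nhdsWithin 0 (Set.Ioi 0))
          (nhds |averageSum Ψ P + 0|) :=
        ((by fun_prop : Continuous fun c : ℝ => |averageSum Ψ P + c|).tendsto 0).mono_left
          nhdsWithin_le_nhds
      have h2 : Filter.Tendsto (fun c : ℝ => C * c) (nhdsWithin 0 (Set.Ioi 0))
          (nhds (C * 0)) :=
        ((by fun_prop : Continuous fun c : ℝ => C * c).tendsto 0).mono_left nhdsWithin_le_nhds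
      exact le_of_tendsto_of_tendsto h1 h2
        (Filter.eventually_of_mem self_mem_nhdsWithin fun c hc => hlim c hc)
    rw [h0]
    simpa using hcont
  · exact key Ψ h0

end LHV

end Violation


/-! ### From bounded violations to a simulating measure -/

section Extension

variable {N : ℕ} {S : Fin N → ℕ}

theorem totalVariation_sub_le {X : Type*} [MeasurableSpace X] (μ₁ μ₂ : Measure X)
    [IsFiniteMeasure μ₁] [IsFiniteMeasure μ₂] :
    (μ₁.toSignedMeasure - μ₂.toSignedMeasure).totalVariation ≤ μ₁ + μ₂ := by
  rw [SignedMeasure.totalVariation_eq_variation]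
  refine VectorMeasure.variation_sub_le.trans ?_
  rw [Measure.variation_toSignedMeasure, Measure.variation_toSignedMeasure]

theorem continuous_settingProj {K : Type*} [TopologicalSpace K] (s : ∀ n, Fin (S n)) :
    Continuous (settingProj (Λ := fun _ : Fin N => K) s) := by
  unfold settingProj
  fun_prop

/-- The linear map `g ↦ ∑_s g_s ∘ π_s` on families of continuous functions. -/
def continuousBellMap (S : Fin N → ℕ) (K : Type*) [TopologicalSpace K] :
    ((∀ n, Fin (S n)) → C(Fin N → K, ℝ)) →ₗ[ℝ] C(∀ n, Fin (S n) → K, ℝ) where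
  toFun g := ∑ s, (g s).comp ⟨settingProj s, continuous_settingProj s⟩
  map_add' g g' := by
    ext w
    simp [ContinuousMap.sum_apply, Finset.sum_add_distrib]
  map_smul' c g := by
    ext w
    simp [ContinuousMap.sum_apply, Finset.mul_sum]

theorem continuousBellMap_apply {K : Type*} [TopologicalSpace K]
    (g : (∀ n, Fin (S n)) → C(Fin N → K, ℝ)) (w : ∀ n, Fin (S n) → K) :
    continuousBellMap S K g w = ∑ s, g s (settingProj s w) := by
  simp [continuousBellMap, ContinuousMap.sum_apply]

variable {Λ : Fin N → Type v} [∀ n, MeasurableSpace (Λ n)]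

/-- If all Bell violations of a scenario on standard Borel spaces are at most `C`, the scenario is
simulated by a real-valued measure of total variation at most `C`. -/
theorem exists_simulates_totalVariation_le [∀ n, StandardBorelSpace (Λ n)] (s₀ : ∀ n, Fin (S n))
    (P : Scenario S Λ) {C : ℝ} (hC0 : 0 ≤ C)
    (hC : ∀ Ψ : FunctionFamily S Λ, |averageSum Ψ P| ≤ C * bellConst Ψ) :
    ∃ μ : SignedMeasure (∀ n, Fin (S n) → Λ n),
      Simulates μ P ∧ μ.totalVariation Set.univ ≤ ENNReal.ofReal C := by
  obtain ⟨l₀⟩ : Nonempty (∀ n, Λ n) := nonempty_of_isProbabilityMeasure (P s₀ : Measure _)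
  have (n : Fin N) : Nonempty (Λ n) := ⟨l₀ n⟩
  -- Measurable embeddings into Cantor space supply the compactness that Riesz representation needs;
  -- standardness of $\Lambda_n$ gives a measurable left inverse for the return.
  choose e he_meas he_inj using fun n =>
    MeasurableSpace.measurable_injection_nat_bool_of_countablySeparated (Λ n)
  have he (n : Fin N) : MeasurableEmbedding (e n) := (he_meas n).measurableEmbedding (he_inj n)
  let E : (∀ n, Λ n) → Fin N → ℕ → Bool := fun l n => e n (l n)
  have hE : Measurable E := by fun_prop
  let r : (Fin N → ℕ → Bool) → ∀ n, Λ n := fun k n => (he n).invFun (k n)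
  have hr : Measurable r :=
    measurable_pi_lambda _ fun n => (he n).measurable_invFun.comp (measurable_pi_apply n)
  have hrE : r ∘ E = id := by
    ext l n
    exact (he n).leftInverse_invFun (l n)
  let R : (∀ n, Fin (S n) → ℕ → Bool) → ∀ n, Fin (S n) → Λ n :=
    fun w n i => (he n).invFun (w n i)
  have hR : Measurable R :=
    measurable_pi_lambda _ fun n => measurable_pi_lambda _ fun i =>
      (he n).measurable_invFun.comp ((measurable_pi_apply i).comp (measurable_pi_apply n))
  let Ψ : ((∀ n, Fin (S n)) → C(Fin N → ℕ → Bool, ℝ)) → FunctionFamily S Λ := fun g =>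
    { toFun := fun s l => g s (E l)
      measurable := fun s => (g s).continuous.measurable.comp hE
      bounded := fun s => ⟨‖g s‖, fun l => (g s).norm_coe_le_norm (E l)⟩ }
  have hint : ∀ s (f : C(Fin N → ℕ → Bool, ℝ)),
      Integrable (fun l => f (E l)) (P s : Measure (∀ n, Λ n)) := fun s f =>
    (Ψ fun _ => f).integrable s _
  let L : ((∀ n, Fin (S n)) → C(Fin N → ℕ → Bool, ℝ)) →ₗ[ℝ] ℝ :=
    { toFun := fun g => averageSum (Ψ g) P
      map_add' := fun g g' => by
        unfold averageSum
        rw [← Finset.sum_add_distrib]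
        exact Finset.sum_congr rfl fun s _ => integral_add (hint s (g s)) (hint s (g' s))
      map_smul' := fun c g => by
        unfold averageSum
        rw [RingHom.id_apply, smul_eq_mul, Finset.mul_sum]
        exact Finset.sum_congr rfl fun s _ => integral_const_mul c _ }
  obtain ⟨μ₁, μ₂, hμ₁, hμ₂, hle, hμ⟩ :=
    exists_measures_of_abs_le (continuousBellMap S (ℕ → Bool)) L hC0 fun g => by
      refine (hC (Ψ g)).trans (mul_le_mul_of_nonneg_left ?_ hC0)
      -- The Bell function of `Ψ g` is the continuous one restricted to the embedded points, so its
      -- sup norm can only be smaller.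
      refine bellConst_le _ (norm_nonneg _) fun w => ?_
      have := (continuousBellMap S (ℕ → Bool) g).norm_coe_le_norm fun n i => e n (w n i)
      rwa [continuousBellMap_apply] at this
  have hmarg : ∀ s, μ₁.map (settingProj s) =
      μ₂.map (settingProj s) + (P s : Measure (∀ n, Λ n)).map E := by
    intro s
    have hs := measurable_settingProj (Λ := fun _ : Fin N => ℕ → Bool) s
    refine ext_of_forall_integral_eq_of_IsFiniteMeasure fun f => ?_
    -- A family with a single nonzero member isolates the marginal for `s`.
    have h := hμ (Pi.single s f.toContinuousMap)
    have hT : ∀ w, continuousBellMap S (ℕ → Bool) (Pi.single s f.toContinuousMap) w =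
        f (settingProj s w) := by
      intro w
      rw [continuousBellMap_apply, Finset.sum_eq_single s]
      · simp
      · intro t _ hts
        simp [Pi.single_eq_of_ne hts]
      · simp
    have hL : L (Pi.single s f.toContinuousMap) =
        ∫ l, f (E l) ∂(P s : Measure (∀ n, Λ n)) := by
      refine (Finset.sum_eq_single s ?_ ?_).trans ?_
      · intro t _ hts
        simp [Ψ, Pi.single_eq_of_ne hts]
      · simp
      · simp [Ψ]
    simp only [hT, hL] at h
    have hfm := f.continuous.measurable.aestronglyMeasurable
      (μ := (P s : Measure (∀ n, Λ n)).map E)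
    rw [integral_add_measure (f.integrable _) (f.integrable _),
      integral_map hs.aemeasurable f.continuous.aestronglyMeasurable,
      integral_map hs.aemeasurable f.continuous.aestronglyMeasurable,
      integral_map hE.aemeasurable hfm]
    exact sub_eq_iff_eq_add'.1 h
  have hmap : ∀ (μ : Measure (∀ n, Fin (S n) → ℕ → Bool)) s,
      (μ.map R).map (settingProj s) = (μ.map (settingProj s)).map r := fun μ s => by
    rw [Measure.map_map (measurable_settingProj s) hR,
      Measure.map_map hr (measurable_settingProj s)]
    rfl
  have hmarg' : ∀ s, (μ₁.map R).map (settingProj s) =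
      (μ₂.map R).map (settingProj s) + (P s : Measure (∀ n, Λ n)) := by
    intro s
    rw [hmap, hmap, hmarg s, Measure.map_add _ _ hr, Measure.map_map hr hE, hrE, Measure.map_id]
  let μ : SignedMeasure (∀ n, Fin (S n) → Λ n) :=
    (μ₁.map R).toSignedMeasure - (μ₂.map R).toSignedMeasure
  have hμmap : ∀ s, μ.map (settingProj s) = (P s : Measure (∀ n, Λ n)).toSignedMeasure := by
    intro s
    have hs := measurable_settingProj (Λ := Λ) s
    ext F hF
    rw [VectorMeasure.map_apply _ hs hF, Measure.toSignedMeasure_sub_apply (hs hF),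
      Measure.toSignedMeasure_apply_measurable hF, ← map_measureReal_apply hs hF,
      ← map_measureReal_apply hs hF, hmarg' s, measureReal_add_apply, add_sub_cancel_left]
  refine ⟨μ, ⟨?_, hμmap⟩, ?_⟩
  -- The total mass is read off from one marginal, a probability measure.
  · have h := congrArg (fun v : SignedMeasure (∀ n, Λ n) => v Set.univ) (hμmap s₀)
    simpa [VectorMeasure.map_apply _ (measurable_settingProj s₀) MeasurableSet.univ] using h
  · refine (totalVariation_sub_le (μ₁.map R) (μ₂.map R) Set.univ).trans ?_
    rw [Measure.add_apply, Measure.map_apply hR MeasurableSet.univ,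
      Measure.map_apply hR MeasurableSet.univ, Set.preimage_univ, ← Measure.add_apply,
      ← ofReal_measureReal, measureReal_add_apply]
    exact ENNReal.ofReal_le_ofReal hle

/-- For a scenario on standard Borel spaces, the scenario parameter is the maximal Bell
violation. -/
theorem scenarioParam_eq_iSup [∀ n, StandardBorelSpace (Λ n)] (s₀ : ∀ n, Fin (S n))
    (P : Scenario S Λ) :
    scenarioParam P = ⨆ (Ψ : FunctionFamily S Λ) (_ : bellConst Ψ ≠ 0),
      ENNReal.ofReal |(bellConst Ψ)⁻¹ * averageSum Ψ P| := by
  refine le_antisymm ?_ (iSup₂_le fun Ψ hΨ => ofReal_violation_le_scenarioParam P Ψ hΨ)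
  set U : ENNReal := ⨆ (Ψ : FunctionFamily S Λ) (_ : bellConst Ψ ≠ 0),
    ENNReal.ofReal |(bellConst Ψ)⁻¹ * averageSum Ψ P| with hU
  rcases eq_or_ne U ⊤ with h | h
  · rw [h]
    exact le_top
  have hC : ∀ Ψ : FunctionFamily S Λ, bellConst Ψ ≠ 0 →
      |(bellConst Ψ)⁻¹ * averageSum Ψ P| ≤ U.toReal := fun Ψ hΨ =>
    (ENNReal.ofReal_le_iff_le_toReal h).1
      (le_iSup₂ (f := fun (Ψ : FunctionFamily S Λ) (_ : bellConst Ψ ≠ 0) =>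
        ENNReal.ofReal |(bellConst Ψ)⁻¹ * averageSum Ψ P|) Ψ hΨ)
  obtain ⟨l₀⟩ : Nonempty (∀ n, Λ n) := nonempty_of_isProbabilityMeasure (P s₀ : Measure _)
  have : Nonempty (∀ n, Fin (S n) → Λ n) := ⟨fun n _ => l₀ n⟩
  obtain ⟨μ, hμ, hle⟩ := exists_simulates_totalVariation_le s₀ P ENNReal.toReal_nonneg
    (abs_averageSum_le_mul_bellConst s₀ hC)
  rw [ENNReal.ofReal_toReal h] at hle
  exact (iInf₂_le μ hμ).trans hle

end Extension

end Duality

end BellViolation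

theorem lemma3 {N : ℕ} (hN : 2 ≤ N) (S : Fin N → ℕ) (hS : ∀ n, 1 ≤ S n)
    {H : Fin N → Type*} [∀ n, NormedAddCommGroup (H n)] [∀ n, InnerProductSpace ℂ (H n)]
    [∀ n, CompleteSpace (H n)] [∀ n, TopologicalSpace.SeparableSpace (H n)]
    (Λ : Fin N → Type v) [∀ n, MeasurableSpace (Λ n)] [∀ n, StandardBorelSpace (Λ n)]
    (ρ : BellViolation.HilbertTensor H →L[ℂ] BellViolation.HilbertTensor H)
    (hρ : BellViolation.IsQuantumState ρ) :
    BellViolation.stateParam S Λ ρ =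
      ⨆ (M : ∀ n, Fin (S n) → BellViolation.POVM (H n) (Λ n)) (P : BellViolation.Scenario S Λ)
        (_ : BellViolation.IsQuantumScenario ρ M P) (Ψ : BellViolation.FunctionFamily S Λ)
        (_ : BellViolation.bellConst Ψ ≠ 0),
        ENNReal.ofReal
          |(BellViolation.bellConst Ψ)⁻¹ * BellViolation.averageSum Ψ P| := by
  refine iSup_congr fun M => iSup_congr fun P => iSup_congr fun _ => ?_
  -- `hS` provides a tuple of settings: the first one at every site.
  exact BellViolation.scenarioParam_eq_iSup (fun n => ⟨0, hS n⟩) P
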